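/- For $n\ge 1$ and an invertible matrix $F\in M_n(\mathbb{C})$ let $\mathrm{Pol}(O_F^+)$ be the universal unital complex $*$-algebra generated by $n^2$ elements $(u_{ij})_{1\le i,j\le n}$ such that the matrices $U=(u_{ij})$ and $\overline U=(u_{ij}^*)$ are both unitary and $U=F\,\overline U F^{-1}$. It is a $*$-bialgebra with coproduct $\Delta(u_{ij})=\sum_k u_{ik}\otimes u_{kj}$ and counit $\varepsilon(u_{ij})=\delta_{ij}$. For $N\in\mathbb{N}$ put $O_N^+ = O_{I_N}^+$ (so that the generators are self-adjoint), and let $O_{J_N}^+$ be the quantum group obtained from $F=J_N=\begin{pmatrix}0&I_N\\-I_N&0\end{pmatrix}\in M_{2N}(\mathbb{C})$. A linear functional $\phi:\mathrm{Pol}(O_F^+)\to\mathbb{C}$ is called a generating functional if $\phi(1)=0$, $\phi(b^*)=\overline{\phi(b)}$ for all $b$, and $\phi(b^*b)\ge 0$ for all $b\in\ker\varepsilon$; it is called Gaussian if moreover $\phi(b_1b_2b_3)=0$ for all $b_1,b_2,b_3\in\ker\varepsilon$; and it is called central if $(\phi\otimes\psi)\circ\Delta=(\psi\otimes\phi)\circ\Delta$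 for every linear functional $\psi$ on $\mathrm{Pol}(O_F^+)$. Proposition. Let $N\ge 2$. Every central Gaussian generating functional on $\mathrm{Pol}(O_N^+)$ is zero, and every central Gaussian generating functional on $\mathrm{Pol}(O_{J_N}^+)$ is zero. -/

import Mathlib

open scoped TensorProduct ComplexOrder

noncomputable section

/-! ### Universal `*`-algebras given by generators and relations -/

/-- The free unital complex `*`-algebra on `X`: noncommutative polynomials in the letters
`(x, false)`, standing for `x`, and `(x, true)`, standing for `x*`. -/
def FreeStarAlgebra (X : Type*) : Type _ := FreeAlgebra ℂ (X × Bool)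

namespace FreeStarAlgebra

variable {X : Type*}

instance : Ring (FreeStarAlgebra X) := inferInstanceAs (Ring (FreeAlgebra ℂ (X × Bool)))

instance : Algebra ℂ (FreeStarAlgebra X) :=
  inferInstanceAs (Algebra ℂ (FreeAlgebra ℂ (X × Bool)))

/-- A letter of the free `*`-algebra. -/
def letter (y : X × Bool) : FreeStarAlgebra X := FreeAlgebra.ι ℂ y

/-- The generator `x`. -/
def of (x : X) : FreeStarAlgebra X := letter (x, false)

theorem induction {p : FreeStarAlgebra X → Prop}
    (h_scalar : ∀ c : ℂ, p (algebraMap ℂ _ c)) (h_letter : ∀ y, p (letter y))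
    (h_mul : ∀ a b, p a → p b → p (a * b)) (h_add : ∀ a b, p a → p b → p (a + b))
    (a : FreeStarAlgebra X) : p a :=
  FreeAlgebra.induction ℂ (X × Bool) h_scalar h_letter h_mul h_add a

/-- The opposite algebra of the free `*`-algebra, with `ℂ` acting through complex conjugation. -/
abbrev conjAlgebra (X : Type*) : Algebra ℂ (FreeStarAlgebra X)ᵐᵒᵖ :=
  RingHom.toAlgebra' ((algebraMap ℂ (FreeStarAlgebra X)ᵐᵒᵖ).comp (starRingEnd ℂ))
    (fun c x => Algebra.commutes (starRingEnd ℂ c) x)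

/-- The involution as a ring homomorphism to the opposite algebra: it is conjugate linear and
exchanges `x` and `x*`. -/
def starHom (X : Type*) : FreeStarAlgebra X →+* (FreeStarAlgebra X)ᵐᵒᵖ :=
  letI := conjAlgebra X
  (FreeAlgebra.lift ℂ
    (fun y : X × Bool => MulOpposite.op (letter (y.1, !y.2)))).toRingHom

theorem starHom_letter (y : X × Bool) :
    starHom X (letter y) = MulOpposite.op (letter (y.1, !y.2)) :=
  letI := conjAlgebra X
  FreeAlgebra.lift_ι_apply (R := ℂ)
    (fun y : X × Bool => MulOpposite.op (letter (y.1, !y.2))) y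

theorem starHom_algebraMap (c : ℂ) :
    starHom X (algebraMap ℂ _ c) = MulOpposite.op (algebraMap ℂ _ (star c)) :=
  letI := conjAlgebra X
  AlgHom.commutes (FreeAlgebra.lift ℂ
    (fun y : X × Bool => MulOpposite.op (letter (y.1, !y.2)))) c

instance : StarRing (FreeStarAlgebra X) where
  star a := (starHom X a).unop
  star_involutive a := by
    induction a using FreeStarAlgebra.induction with
    | h_scalar c => simp [starHom_algebraMap]
    | h_letter y => simp [starHom_letter]
    | h_mul a b ha hb => simp [ha, hb]
    | h_add a b ha hb => simp [ha, hb]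
  star_mul a b := by simp
  star_add a b := by simp

theorem star_def (a : FreeStarAlgebra X) : star a = (starHom X a).unop := rfl

theorem star_letter (y : X × Bool) : star (letter y) = letter (y.1, !y.2) := by
  simp [star_def, starHom_letter]

theorem star_algebraMap (c : ℂ) :
    star (algebraMap ℂ (FreeStarAlgebra X) c) = algebraMap ℂ _ (star c) := by
  rw [star_def, starHom_algebraMap, MulOpposite.unop_op]

instance : StarModule ℂ (FreeStarAlgebra X) where
  star_smul c a := by
    rw [Algebra.smul_def, star_mul, star_algebraMap, Algebra.smul_def, Algebra.commutes]

variable {A : Type*} [Ring A] [Algebra ℂ A] [StarRing A] [StarModule ℂ A]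

/-- The `*`-homomorphism determined by the images of the generators. -/
def lift (f : X → A) : FreeStarAlgebra X →⋆ₐ[ℂ] A where
  toAlgHom := FreeAlgebra.lift ℂ (fun y : X × Bool => bif y.2 then star (f y.1) else f y.1)
  map_star' a := by
    induction a using FreeStarAlgebra.induction with
    | h_scalar c =>
      rw [star_algebraMap]
      simp only [AlgHom.toFun_eq_coe]
      erw [AlgHom.commutes, AlgHom.commutes]
      exact algebraMap_star_comm c
    | h_letter y =>
      rw [star_letter]
      simp only [AlgHom.toFun_eq_coe]
      erw [FreeAlgebra.lift_ι_apply, FreeAlgebra.lift_ι_apply]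
      rcases y with ⟨x, _ | _⟩ <;> simp
    | h_mul a b ha hb =>
      simp only [AlgHom.toFun_eq_coe] at ha hb ⊢
      rw [star_mul]
      erw [map_mul, map_mul, ha, hb, star_mul]
    | h_add a b ha hb =>
      simp only [AlgHom.toFun_eq_coe] at ha hb ⊢
      rw [star_add]
      erw [map_add, map_add, ha, hb, star_add]

theorem lift_of (f : X → A) (x : X) : lift f (of x) = f x :=
  FreeAlgebra.lift_ι_apply (R := ℂ) _ (x, false)

end FreeStarAlgebra

/-- The relations `r` together with their adjoints. -/
inductive StarRel {A : Type*} [Star A] (r : A → A → Prop) : A → A → Prop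
  | of {a b : A} : r a b → StarRel r a b
  | adjoint {a b : A} : r a b → StarRel r (star a) (star b)

/-- The universal unital complex `*`-algebra generated by `X` subject to the relations `a = b` for
`r a b`, i.e. the quotient of the free `*`-algebra by the `*`-ideal generated by all `a - b`. -/
def UniversalStarAlgebra (X : Type*) (r : FreeStarAlgebra X → FreeStarAlgebra X → Prop) : Type _ :=
  RingQuot (StarRel r)

namespace UniversalStarAlgebra

variable {X : Type*} {r : FreeStarAlgebra X → FreeStarAlgebra X → Prop}

instance : Ring (UniversalStarAlgebra X r) := inferInstanceAs (Ring (RingQuot (StarRel r)))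

instance : Algebra ℂ (UniversalStarAlgebra X r) :=
  inferInstanceAs (Algebra ℂ (RingQuot (StarRel r)))

theorem starRel_star (a b : FreeStarAlgebra X) (h : StarRel r a b) :
    StarRel r (star a) (star b) := by
  cases h with
  | of h => exact .adjoint h
  | adjoint h => simpa using StarRel.of h

/-- The quotient map from the free `*`-algebra. -/
def mk (r : FreeStarAlgebra X → FreeStarAlgebra X → Prop) :
    FreeStarAlgebra X →ₐ[ℂ] UniversalStarAlgebra X r :=
  RingQuot.mkAlgHom ℂ (StarRel r)

theorem mk_surjective : Function.Surjective (mk r) := RingQuot.mkAlgHom_surjective ℂ _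

/-- The involution induced from the free `*`-algebra, as a ring homomorphism to the opposite
algebra. -/
def starHom (r : FreeStarAlgebra X → FreeStarAlgebra X → Prop) :
    UniversalStarAlgebra X r →+* (UniversalStarAlgebra X r)ᵐᵒᵖ :=
  RingQuot.lift ⟨(RingHom.op (mk r).toRingHom).comp (FreeStarAlgebra.starHom X), by
    intro a b h
    exact congrArg MulOpposite.op (RingQuot.mkAlgHom_rel ℂ (starRel_star a b h))⟩

theorem starHom_mk (a : FreeStarAlgebra X) :
    starHom r (mk r a) = MulOpposite.op (mk r (star a)) := by
  have h : mk r a = RingQuot.mkRingHom (StarRel r) a :=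
    RingHom.congr_fun (RingQuot.mkAlgHom_coe ℂ (StarRel r)) a
  rw [h]
  exact RingQuot.lift_mkRingHom_apply _ _ a

instance : StarRing (UniversalStarAlgebra X r) where
  star a := (starHom r a).unop
  star_involutive a := by
    obtain ⟨a, rfl⟩ := mk_surjective a
    simp [starHom_mk]
  star_mul a b := by simp
  star_add a b := by simp

theorem mk_star (a : FreeStarAlgebra X) : mk r (star a) = star (mk r a) :=
  (congrArg MulOpposite.unop (starHom_mk a)).symm

theorem mk_rel {a b : FreeStarAlgebra X} (h : r a b) : mk r a = mk r b :=
  RingQuot.mkAlgHom_rel ℂ (StarRel.of h)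

instance : StarModule ℂ (UniversalStarAlgebra X r) where
  star_smul c a := by
    obtain ⟨a, rfl⟩ := mk_surjective a
    rw [← map_smul, ← mk_star, star_smul, map_smul, mk_star]

/-- The generator `x`. -/
def of (r : FreeStarAlgebra X → FreeStarAlgebra X → Prop) (x : X) : UniversalStarAlgebra X r :=
  mk r (FreeStarAlgebra.of x)

variable {A : Type*} [Ring A] [Algebra ℂ A] [StarRing A] [StarModule ℂ A]

/-- The `*`-homomorphism determined by images of the generators that satisfy the relations. -/
def lift (f : X → A)
    (hf : ∀ a b, r a b → FreeStarAlgebra.lift f a = FreeStarAlgebra.lift f b) :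
    UniversalStarAlgebra X r →⋆ₐ[ℂ] A where
  toAlgHom := RingQuot.liftAlgHom ℂ ⟨(FreeStarAlgebra.lift f).toAlgHom, by
    intro a b h
    cases h with
    | of h => exact hf _ _ h
    | adjoint h =>
      have := congrArg star (hf _ _ h)
      rwa [← map_star, ← map_star] at this⟩
  map_star' a := by
    obtain ⟨a, rfl⟩ := mk_surjective a
    rw [← mk_star]
    simp only [AlgHom.toFun_eq_coe, mk]
    erw [RingQuot.liftAlgHom_mkAlgHom_apply, RingQuot.liftAlgHom_mkAlgHom_apply]
    exact map_star (FreeStarAlgebra.lift f) a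

theorem lift_of (f : X → A)
    (hf : ∀ a b, r a b → FreeStarAlgebra.lift f a = FreeStarAlgebra.lift f b) (x : X) :
    lift f hf (of r x) = f x :=
  (RingQuot.liftAlgHom_mkAlgHom_apply ℂ _ _ _).trans (FreeStarAlgebra.lift_of f x)

/-- Algebra homomorphisms that agree on the generators and on their adjoints are equal. -/
theorem algHom_ext {B : Type*} [Semiring B] [Algebra ℂ B] {f g : UniversalStarAlgebra X r →ₐ[ℂ] B}
    (h : ∀ x, f (of r x) = g (of r x)) (h' : ∀ x, f (star (of r x)) = g (star (of r x))) :
    f = g := by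
  ext a
  obtain ⟨a, rfl⟩ := mk_surjective a
  induction a using FreeStarAlgebra.induction with
  | h_scalar c => simp
  | h_letter y =>
    rcases y with ⟨x, _ | _⟩
    · exact h x
    · have := h' x
      rwa [of, FreeStarAlgebra.of, ← mk_star, FreeStarAlgebra.star_letter] at this
  | h_mul a b ha hb => simp [ha, hb]
  | h_add a b ha hb => simp [ha, hb]

end UniversalStarAlgebra

/-! ### Free orthogonal quantum groups -/

section FreeOrthogonal

open Matrix

/-- The matrix of generators `u i j` of the free `*`-algebra. -/
def freeMatrix (ι : Type*) : Matrix ι ι (FreeStarAlgebra (ι × ι)) :=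
  Matrix.of fun i j => FreeStarAlgebra.of (i, j)

set_option linter.unusedSectionVars false

variable {ι : Type*} [Fintype ι] [DecidableEq ι]

/-- The entries of the relations saying that `U = (u i j)` and `Ū = ((u i j)*)` are unitary. -/
inductive UnitaryRel : FreeStarAlgebra (ι × ι) → FreeStarAlgebra (ι × ι) → Prop
  | mul_adjoint (i j : ι) : UnitaryRel ((freeMatrix ι * (freeMatrix ι)ᴴ) i j)
      ((1 : Matrix ι ι (FreeStarAlgebra (ι × ι))) i j)
  | adjoint_mul (i j : ι) : UnitaryRel (((freeMatrix ι)ᴴ * freeMatrix ι) i j)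
      ((1 : Matrix ι ι (FreeStarAlgebra (ι × ι))) i j)
  | conj_mul_adjoint (i j : ι) :
      UnitaryRel (((freeMatrix ι).map star * ((freeMatrix ι).map star)ᴴ) i j)
        ((1 : Matrix ι ι (FreeStarAlgebra (ι × ι))) i j)
  | conj_adjoint_mul (i j : ι) :
      UnitaryRel ((((freeMatrix ι).map star)ᴴ * (freeMatrix ι).map star) i j)
        ((1 : Matrix ι ι (FreeStarAlgebra (ι × ι))) i j)

/-- A scalar matrix viewed as a matrix over a complex algebra. -/
abbrev scalarMatrix (A : Type*) [Ring A] [Algebra ℂ A] (F : Matrix ι ι ℂ) : Matrix ι ι A :=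
  F.map (algebraMap ℂ A)

/-- The relations of `UnitaryRel` together with the entries of `U = F Ū F⁻¹`. -/
inductive OrthogonalRel (F : (Matrix ι ι ℂ)ˣ) :
    FreeStarAlgebra (ι × ι) → FreeStarAlgebra (ι × ι) → Prop
  | unitary {a b : FreeStarAlgebra (ι × ι)} : UnitaryRel a b → OrthogonalRel F a b
  | conj (i j : ι) : OrthogonalRel F (freeMatrix ι i j)
      ((scalarMatrix (FreeStarAlgebra (ι × ι)) (F : Matrix ι ι ℂ) * (freeMatrix ι).map star *
        scalarMatrix (FreeStarAlgebra (ι × ι)) ((F⁻¹ : (Matrix ι ι ℂ)ˣ) : Matrix ι ι ℂ) :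
          Matrix ι ι (FreeStarAlgebra (ι × ι))) i j)

/-- `Pol(O_F⁺)`: the universal `*`-algebra generated by elements `u i j` such that `U` and `Ū` are
unitary (which gives `Pol(U_n⁺)`) and `U = F Ū F⁻¹`. -/
abbrev PolOF (F : (Matrix ι ι ℂ)ˣ) : Type _ := UniversalStarAlgebra (ι × ι) (OrthogonalRel F)

/-- The relations `OrthogonalRel F` for a matrix over an arbitrary `*`-algebra. -/
structure IsOrthogonalMatrix (F : (Matrix ι ι ℂ)ˣ) {A : Type*} [Ring A] [Algebra ℂ A] [StarRing A]
    (M : Matrix ι ι A) : Prop where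
  mul_adjoint : M * Mᴴ = 1
  adjoint_mul : Mᴴ * M = 1
  conj_mul_adjoint : M.map star * (M.map star)ᴴ = 1
  conj_adjoint_mul : (M.map star)ᴴ * M.map star = 1
  conj : M = scalarMatrix A (F : Matrix ι ι ℂ) * M.map star *
    scalarMatrix A ((F⁻¹ : (Matrix ι ι ℂ)ˣ) : Matrix ι ι ℂ)

section Maps

variable {A B : Type*} [Ring A] [Algebra ℂ A] [StarRing A]
  [Ring B] [Algebra ℂ B] [StarRing B]

theorem map_map_star (f : A →⋆ₐ[ℂ] B) (M : Matrix ι ι A) :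
    (M.map star).map f = (M.map f).map star := by
  ext i j
  simp [map_star]

theorem map_conjTranspose (f : A →⋆ₐ[ℂ] B) (M : Matrix ι ι A) : Mᴴ.map f = (M.map f)ᴴ := by
  ext i j
  simp [map_star]

theorem map_scalarMatrix (f : A →⋆ₐ[ℂ] B) (F : Matrix ι ι ℂ) :
    (scalarMatrix A F).map f = scalarMatrix B F := by
  ext i j
  simp [AlgHomClass.commutes]

theorem map_one_matrix (f : A →⋆ₐ[ℂ] B) : (1 : Matrix ι ι A).map f = 1 :=
  Matrix.map_one f (map_zero f) (map_one f)

theorem IsOrthogonalMatrix.map {F : (Matrix ι ι ℂ)ˣ} {M : Matrix ι ι A}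
    (h : IsOrthogonalMatrix F M) (f : A →⋆ₐ[ℂ] B) : IsOrthogonalMatrix F (M.map f) where
  mul_adjoint := by
    rw [← map_conjTranspose, ← Matrix.map_mul, h.mul_adjoint, map_one_matrix]
  adjoint_mul := by
    rw [← map_conjTranspose, ← Matrix.map_mul, h.adjoint_mul, map_one_matrix]
  conj_mul_adjoint := by
    rw [← map_map_star, ← map_conjTranspose, ← Matrix.map_mul, h.conj_mul_adjoint, map_one_matrix]
  conj_adjoint_mul := by
    rw [← map_map_star, ← map_conjTranspose, ← Matrix.map_mul, h.conj_adjoint_mul, map_one_matrix]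
  conj := by
    conv_lhs => rw [h.conj]
    rw [Matrix.map_mul, Matrix.map_mul, map_map_star, map_scalarMatrix, map_scalarMatrix]

end Maps

namespace PolOF

variable (F : (Matrix ι ι ℂ)ˣ)

/-- The fundamental representation `U = (u i j)`. -/
def fundMatrix : Matrix ι ι (PolOF F) :=
  Matrix.of fun i j => UniversalStarAlgebra.of (OrthogonalRel F) (i, j)

variable {F}

variable {A : Type*} [Ring A] [Algebra ℂ A] [StarRing A] [StarModule ℂ A]

theorem freeMatrix_map (M : Matrix ι ι A) :
    (freeMatrix ι).map (FreeStarAlgebra.lift fun p => M p.1 p.2) = M := by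
  ext i j
  exact FreeStarAlgebra.lift_of _ (i, j)

theorem lift_rel {M : Matrix ι ι A} (h : IsOrthogonalMatrix F M) (a b : FreeStarAlgebra (ι × ι))
    (hab : OrthogonalRel F a b) :
    FreeStarAlgebra.lift (fun p : ι × ι => M p.1 p.2) a =
      FreeStarAlgebra.lift (fun p : ι × ι => M p.1 p.2) b := by
  have key : ∀ P Q : Matrix ι ι (FreeStarAlgebra (ι × ι)),
      P.map (FreeStarAlgebra.lift fun p : ι × ι => M p.1 p.2) =
        Q.map (FreeStarAlgebra.lift fun p : ι × ι => M p.1 p.2) → ∀ i j,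
      FreeStarAlgebra.lift (fun p : ι × ι => M p.1 p.2) (P i j) =
        FreeStarAlgebra.lift (fun p : ι × ι => M p.1 p.2) (Q i j) :=
    fun P Q hPQ i j => congrFun (congrFun hPQ i) j
  cases hab with
  | unitary hab =>
    cases hab with
    | mul_adjoint i j =>
      refine key _ _ ?_ i j
      rw [Matrix.map_mul, map_conjTranspose, freeMatrix_map, map_one_matrix, h.mul_adjoint]
    | adjoint_mul i j =>
      refine key _ _ ?_ i j
      rw [Matrix.map_mul, map_conjTranspose, freeMatrix_map, map_one_matrix, h.adjoint_mul]
    | conj_mul_adjoint i j =>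
      refine key _ _ ?_ i j
      rw [Matrix.map_mul, map_conjTranspose, map_map_star, freeMatrix_map, map_one_matrix,
        h.conj_mul_adjoint]
    | conj_adjoint_mul i j =>
      refine key _ _ ?_ i j
      rw [Matrix.map_mul, map_conjTranspose, map_map_star, freeMatrix_map, map_one_matrix,
        h.conj_adjoint_mul]
  | conj i j =>
    refine key _ _ ?_ i j
    rw [Matrix.map_mul, Matrix.map_mul, map_scalarMatrix, map_scalarMatrix, map_map_star,
      freeMatrix_map]
    exact h.conj

/-- The universal property of `Pol(O_F⁺)`. -/
def lift (M : Matrix ι ι A) (h : IsOrthogonalMatrix F M) : PolOF F →⋆ₐ[ℂ] A :=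
  UniversalStarAlgebra.lift (fun p => M p.1 p.2) (lift_rel h)

theorem lift_fundMatrix (M : Matrix ι ι A) (h : IsOrthogonalMatrix F M) (i j : ι) :
    lift M h (fundMatrix F i j) = M i j :=
  UniversalStarAlgebra.lift_of _ _ (i, j)

theorem isOrthogonalMatrix_fundMatrix : IsOrthogonalMatrix F (fundMatrix F) := by
  let q : FreeStarAlgebra (ι × ι) →⋆ₐ[ℂ] PolOF F :=
    { UniversalStarAlgebra.mk (OrthogonalRel F) with map_star' := UniversalStarAlgebra.mk_star }
  have hq : (freeMatrix ι).map q = fundMatrix F := rfl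
  have hr : ∀ a b, OrthogonalRel F a b → q a = q b := fun a b h => UniversalStarAlgebra.mk_rel h
  constructor
  · rw [← hq, ← map_conjTranspose, ← Matrix.map_mul, ← map_one_matrix q]
    ext i j
    exact hr _ _ (.unitary (.mul_adjoint i j))
  · rw [← hq, ← map_conjTranspose, ← Matrix.map_mul, ← map_one_matrix q]
    ext i j
    exact hr _ _ (.unitary (.adjoint_mul i j))
  · rw [← hq, ← map_map_star, ← map_conjTranspose, ← Matrix.map_mul, ← map_one_matrix q]
    ext i j
    exact hr _ _ (.unitary (.conj_mul_adjoint i j))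
  · rw [← hq, ← map_map_star, ← map_conjTranspose, ← Matrix.map_mul, ← map_one_matrix q]
    ext i j
    exact hr _ _ (.unitary (.conj_adjoint_mul i j))
  · rw [← hq, ← map_map_star, ← map_scalarMatrix q, ← map_scalarMatrix q, ← Matrix.map_mul,
      ← Matrix.map_mul]
    ext i j
    exact hr _ _ (.conj i j)

theorem scalarMatrix_mul_inv (A : Type*) [Ring A] [Algebra ℂ A] (F : (Matrix ι ι ℂ)ˣ) :
    scalarMatrix A (F : Matrix ι ι ℂ) *
      scalarMatrix A ((F⁻¹ : (Matrix ι ι ℂ)ˣ) : Matrix ι ι ℂ) = 1 := by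
  rw [scalarMatrix, scalarMatrix, ← Matrix.map_mul, Units.mul_inv,
    Matrix.map_one _ (map_zero _) (map_one _)]

theorem scalarMatrix_inv_mul (A : Type*) [Ring A] [Algebra ℂ A] (F : (Matrix ι ι ℂ)ˣ) :
    scalarMatrix A ((F⁻¹ : (Matrix ι ι ℂ)ˣ) : Matrix ι ι ℂ) *
      scalarMatrix A (F : Matrix ι ι ℂ) = 1 := by
  rw [scalarMatrix, scalarMatrix, ← Matrix.map_mul, Units.inv_mul,
    Matrix.map_one _ (map_zero _) (map_one _)]

theorem isOrthogonalMatrix_one : IsOrthogonalMatrix F (1 : Matrix ι ι ℂ) := by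
  have h : (1 : Matrix ι ι ℂ).map star = 1 := Matrix.map_one _ (star_zero _) (star_one _)
  constructor
  · simp
  · simp
  · simp
  · simp
  · rw [h, mul_one, scalarMatrix_mul_inv]

variable (F)

/-- The counit, `ε(u i j) = δ i j`. -/
def counit : PolOF F →⋆ₐ[ℂ] ℂ := lift 1 isOrthogonalMatrix_one

/-- The matrix with entries `∑ k, u i k ⊗ u k j`. -/
def comulMatrix : Matrix ι ι (PolOF F ⊗[ℂ] PolOF F) :=
  Matrix.of fun i j => ∑ k, fundMatrix F i k ⊗ₜ[ℂ] fundMatrix F k j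

theorem isOrthogonalMatrix_comulMatrix : IsOrthogonalMatrix F (comulMatrix F) := by
  let l : PolOF F →⋆ₐ[ℂ] PolOF F ⊗[ℂ] PolOF F :=
    { Algebra.TensorProduct.includeLeft (R := ℂ) (S := ℂ) (A := PolOF F) (B := PolOF F) with
      map_star' := fun a => by simp }
  let r : PolOF F →⋆ₐ[ℂ] PolOF F ⊗[ℂ] PolOF F :=
    { Algebra.TensorProduct.includeRight (R := ℂ) (A := PolOF F) (B := PolOF F) with
      map_star' := fun a => by simp }
  have hl (a : PolOF F) : l a = a ⊗ₜ[ℂ] 1 := rfl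
  have hr (a : PolOF F) : r a = 1 ⊗ₜ[ℂ] a := rfl
  have h₁ : IsOrthogonalMatrix F ((fundMatrix F).map l) := isOrthogonalMatrix_fundMatrix.map l
  have h₂ : IsOrthogonalMatrix F ((fundMatrix F).map r) := isOrthogonalMatrix_fundMatrix.map r
  have hM : comulMatrix F = (fundMatrix F).map l * (fundMatrix F).map r := by
    ext i j
    simp [comulMatrix, Matrix.mul_apply, hl, hr]
  have hM' : (comulMatrix F).map star =
      ((fundMatrix F).map l).map star * ((fundMatrix F).map r).map star := by
    ext i j
    simp [comulMatrix, Matrix.mul_apply, hl, hr]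
  constructor
  · rw [hM, conjTranspose_mul, mul_assoc, ← mul_assoc _ _ (((fundMatrix F).map l)ᴴ),
      h₂.mul_adjoint, one_mul, h₁.mul_adjoint]
  · rw [hM, conjTranspose_mul, mul_assoc, ← mul_assoc _ _ ((fundMatrix F).map r),
      h₁.adjoint_mul, one_mul, h₂.adjoint_mul]
  · rw [hM', conjTranspose_mul, mul_assoc, ← mul_assoc _ _ ((((fundMatrix F).map l).map star)ᴴ),
      h₂.conj_mul_adjoint, one_mul, h₁.conj_mul_adjoint]
  · rw [hM', conjTranspose_mul, mul_assoc, ← mul_assoc _ _ (((fundMatrix F).map r).map star),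
      h₁.conj_adjoint_mul, one_mul, h₂.conj_adjoint_mul]
  · rw [hM', hM]
    nth_rewrite 1 [h₁.conj, h₂.conj]
    simp only [mul_assoc]
    rw [← mul_assoc (scalarMatrix _ ((F⁻¹ : (Matrix ι ι ℂ)ˣ) : Matrix ι ι ℂ))
      (scalarMatrix _ (F : Matrix ι ι ℂ)), scalarMatrix_inv_mul, one_mul]

/-- The coproduct, `Δ(u i j) = ∑ k, u i k ⊗ u k j`. -/
def comul : PolOF F →⋆ₐ[ℂ] PolOF F ⊗[ℂ] PolOF F :=
  lift (comulMatrix F) (isOrthogonalMatrix_comulMatrix F)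

theorem counit_fundMatrix (i j : ι) : counit F (fundMatrix F i j) = (1 : Matrix ι ι ℂ) i j :=
  lift_fundMatrix _ _ i j

theorem comul_fundMatrix (i j : ι) :
    comul F (fundMatrix F i j) = ∑ k, fundMatrix F i k ⊗ₜ[ℂ] fundMatrix F k j :=
  lift_fundMatrix _ _ i j

theorem counit_star (i j : ι) :
    counit F (star (fundMatrix F i j)) = (1 : Matrix ι ι ℂ) i j := by
  rw [map_star, counit_fundMatrix, Matrix.one_apply]
  split_ifs <;> simp

theorem comul_star (i j : ι) : comul F (star (fundMatrix F i j)) =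
    ∑ k, star (fundMatrix F i k) ⊗ₜ[ℂ] star (fundMatrix F k j) := by
  simp [map_star, comul_fundMatrix]

theorem ext_fundMatrix {B : Type*} [Semiring B] [Algebra ℂ B] {f g : PolOF F →ₐ[ℂ] B}
    (h : ∀ i j, f (fundMatrix F i j) = g (fundMatrix F i j))
    (h' : ∀ i j, f (star (fundMatrix F i j)) = g (star (fundMatrix F i j))) : f = g :=
  UniversalStarAlgebra.algHom_ext (fun x => h x.1 x.2) (fun x => h' x.1 x.2)

/-- The bialgebra structure of `Pol(O_F⁺)`. -/
instance : Bialgebra ℂ (PolOF F) :=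
  Bialgebra.ofAlgHom (comul F).toAlgHom (counit F).toAlgHom
    (by
      apply ext_fundMatrix <;> intro i j
      · simp [comul_fundMatrix, TensorProduct.sum_tmul, TensorProduct.tmul_sum]
        exact Finset.sum_comm
      · simp [comul_star, TensorProduct.sum_tmul, TensorProduct.tmul_sum]
        exact Finset.sum_comm)
    (by
      apply ext_fundMatrix <;> intro i j
      · simp [comul_fundMatrix, counit_fundMatrix, Matrix.one_apply, TensorProduct.ite_tmul]
      · simp [comul_star, counit_star, Matrix.one_apply, TensorProduct.ite_tmul])
    (by
      apply ext_fundMatrix <;> intro i j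
      · simp [comul_fundMatrix, counit_fundMatrix, Matrix.one_apply, TensorProduct.tmul_ite]
      · simp [comul_star, counit_star, Matrix.one_apply, TensorProduct.tmul_ite])

end PolOF

/-- `Pol(O_N⁺)`: here `F` is the identity matrix, so that the relation reads `U = Ū`, i.e. the
generators `u i j` are self-adjoint. -/
abbrev PolOPlus (N : ℕ) : Type := PolOF (1 : (Matrix (Fin N) (Fin N) ℂ)ˣ)

/-- The matrix `J_N` of size `2N`, in block form; its inverse is `-J_N`. -/
def symplecticJ (N : ℕ) : (Matrix (Fin N ⊕ Fin N) (Fin N ⊕ Fin N) ℂ)ˣ where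
  val := Matrix.fromBlocks 0 1 (-1) 0
  inv := -Matrix.fromBlocks 0 1 (-1) 0
  val_inv := by simp [Matrix.fromBlocks_neg, Matrix.fromBlocks_multiply]
  inv_val := by simp [Matrix.fromBlocks_neg, Matrix.fromBlocks_multiply]

/-- `Pol(O_{J_N}⁺)`, the free symplectic quantum group, generated by the `(2N)²` entries of `U`. -/
abbrev PolOJPlus (N : ℕ) : Type := PolOF (symplecticJ N)

end FreeOrthogonal

/-! ### Gaussian generating functionals and central functionals -/

section Functionals

variable {B : Type*} [Ring B] [Algebra ℂ B] [StarRing B]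

/-- Generating functionals on the augmented `*`-algebra `(B, ε)`. -/
structure IsGeneratingFunctional (ε : B →⋆ₐ[ℂ] ℂ) (φ : B →ₗ[ℂ] ℂ) : Prop where
  map_one : φ 1 = 0
  hermitian : ∀ b, φ (star b) = star (φ b)
  cond_pos : ∀ b, ε b = 0 → 0 ≤ φ (star b * b)

/-- `K_n(B) = (ker ε)ⁿ`, the linear span of the products of `n` elements of `ker ε`. -/
def augmentationPower (ε : B →⋆ₐ[ℂ] ℂ) (n : ℕ) : Submodule ℂ B :=
  LinearMap.ker ε.toAlgHom.toLinearMap ^ n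

/-- A generating functional is Gaussian if it vanishes on `K_3(B)`. -/
structure IsGaussianGeneratingFunctional (ε : B →⋆ₐ[ℂ] ℂ) (φ : B →ₗ[ℂ] ℂ) : Prop extends
    IsGeneratingFunctional ε φ where
  gaussian : ∀ b ∈ augmentationPower ε 3, φ b = 0

/-- A functional on a coalgebra is central if it commutes with every functional for the
convolution product `φ * ψ = (φ ⊗ ψ) ∘ Δ`. -/
def IsCentralFunctional {C : Type*} [AddCommGroup C] [Module ℂ C] [Coalgebra ℂ C]
    (φ : C →ₗ[ℂ] ℂ) : Prop :=
  ∀ ψ : C →ₗ[ℂ] ℂ,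
    WithConv.toConv φ * WithConv.toConv ψ = WithConv.toConv ψ * WithConv.toConv φ

end Functionals

end

noncomputable section

open Matrix

/-! ### Gaussian functionals on augmented `*`-algebras -/

section Augmented

variable {B : Type*} [Ring B] [Algebra ℂ B] [StarRing B]

/-! Write `C = U - 1`, with entries in `ker ε`. A Gaussian functional vanishes on triple products
from `ker ε`, so it is controlled by its values on entries of `C` and on products of two of them. By
positivity and a Cauchy-Schwarz argument (`IsGeneratingFunctional.mem_formKernel`), the kernel of
the form `(c, b) ↦ φ (c * b)` on `ker ε` consists exactly of the `b` in `ker ε` with `φ (star b * b)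
= 0`.

Centrality is used in two ways. Tested against characters, it makes `φ` invariant under the
conjugations `U ↦ g U gᴴ` by scalar points `g` of the quantum group (`PolOF.map_conjugation`), and
hence also makes the form kernel invariant. Tested against a matrix coefficient of a noncommutative
representation, it gives more: `U` may be sent to a diagonal matrix with anticommuting involutions
in places `i` and `j`, and comparing the two convolutions gives `φ (u i j * u j i) = -φ (u i j * u j
i)` (`PolOF.map_fundMatrix_mul`). Modulo `(ker ε)²` the matrix `C` is anti-hermitian, so this says
that `u i j` is a null vector of the form.

Thus the entries of `C` outside the diagonal blocks of `F` lie in the form kernel, and a sign change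
shows that they lie in `ker φ` too. The remaining task is algebraic: a conjugation-invariant
subspace containing `(ker ε)²` and these entries contains all of `C`. Applied to the form kernel,
this shows that `φ` vanishes on `(ker ε)²`; then `ker φ` is itself such a subspace, and applying it
again gives `φ = 0` (`PolOF.eq_zero_of_isConjInvariant`).

For `F = 1` the blocks are single entries, which are both self-adjoint and anti-hermitian modulo the
subspace. For `F = J_N` the blocks are of size two: real rotations identify the blocks at different
places, and conjugation by a unit quaternion at just one place then kills them. -/

/-- The right kernel of the form `(c, b) ↦ φ (c * b)` on `ker ε`. -/
def formKernel (ε : B →⋆ₐ[ℂ] ℂ) (φ : B →ₗ[ℂ] ℂ) : Submodule ℂ B where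
  carrier := {b | ε b = 0 ∧ ∀ c, ε c = 0 → φ (c * b) = 0}
  zero_mem' := by simp
  add_mem' := by
    rintro a b ⟨ha, ha'⟩ ⟨hb, hb'⟩
    exact ⟨by simp [ha, hb], fun c hc => by simp [mul_add, ha' c hc, hb' c hc]⟩
  smul_mem' := by
    rintro z a ⟨ha, ha'⟩
    exact ⟨by simp [ha], fun c hc => by simp [ha' c hc]⟩

variable {ε : B →⋆ₐ[ℂ] ℂ} {φ : B →ₗ[ℂ] ℂ}

theorem IsGaussianGeneratingFunctional.map_mul_mul (h : IsGaussianGeneratingFunctional ε φ)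
    {a b c : B} (ha : ε a = 0) (hb : ε b = 0) (hc : ε c = 0) : φ (a * b * c) = 0 := by
  apply h.gaussian
  rw [augmentationPower, pow_succ, pow_two]
  exact Submodule.mul_mem_mul (Submodule.mul_mem_mul ha hb) hc

theorem IsGaussianGeneratingFunctional.mul_mem_formKernel
    (h : IsGaussianGeneratingFunctional ε φ) {a b : B} (ha : ε a = 0) (hb : ε b = 0) :
    a * b ∈ formKernel ε φ :=
  ⟨by simp [ha], fun c hc => by rw [← mul_assoc]; exact h.map_mul_mul hc ha hb⟩

/-- Null vectors of the form `φ (star b * c)` lie in its kernel. -/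
theorem IsGeneratingFunctional.mem_formKernel [StarModule ℂ B]
    (h : IsGeneratingFunctional ε φ) {b : B} (hb : ε b = 0) (hbb : φ (star b * b) = 0) :
    b ∈ formKernel ε φ := by
  refine ⟨hb, fun c hc => ?_⟩
  by_contra hne
  set z := φ (c * b) with hz
  have hz' : φ (star b * star c) = star z := by rw [hz, ← h.hermitian, star_mul]
  -- Positivity at `star c - s z̄ b` is affine in `s`, because the quadratic term contains `φ (star
  -- b * b) = 0`. A nonzero slope `-2|z|²` contradicts it for large `s`.
  have key (s : ℝ) : 0 ≤ -2 * s * Complex.normSq z + (φ (c * star c)).re := by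
    have hε : ε (star c - ((s : ℂ) * star z) • b) = 0 := by simp [hb, map_star, hc]
    have h0 := (Complex.le_def.1 (h.cond_pos _ hε)).1
    have h1 : φ (star (star c - ((s : ℂ) * star z) • b) * (star c - ((s : ℂ) * star z) • b)) =
        φ (c * star c) - 2 * s * (z * star z) := by
      simp only [star_sub, star_star, star_smul, sub_mul, mul_sub, smul_mul_assoc, mul_smul_comm,
        map_sub, map_smul, smul_eq_mul, hbb, hz', ← hz, star_mul']
      simp only [RCLike.star_def, Complex.conj_ofReal]
      ring
    rw [h1, RCLike.star_def, Complex.mul_conj] at h0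
    have h2 : (2 * (s : ℂ) * (Complex.normSq z : ℂ)).re = 2 * s * Complex.normSq z := by
      rw [← Complex.ofReal_ofNat, ← Complex.ofReal_mul, ← Complex.ofReal_mul, Complex.ofReal_re]
    rw [Complex.sub_re, h2, Complex.zero_re] at h0
    linarith
  have hpos : 0 < Complex.normSq z := Complex.normSq_pos.2 hne
  -- This `s` makes the affine expression equal to `-1`.
  have := key (((φ (c * star c)).re + 1) / (2 * Complex.normSq z))
  field_simp at this
  linarith

end Augmented

/-! ### The augmentation ideal of `Pol(O_F⁺)` -/

namespace PolOF

variable {ι : Type*} [Fintype ι] [DecidableEq ι] {F : (Matrix ι ι ℂ)ˣ}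

theorem starAlgHom_ext {A : Type*} [Ring A] [Algebra ℂ A] [StarRing A]
    {f g : PolOF F →⋆ₐ[ℂ] A} (h : ∀ i j, f (fundMatrix F i j) = g (fundMatrix F i j)) : f = g := by
  have : f.toAlgHom = g.toAlgHom :=
    ext_fundMatrix F h fun i j => by
      change f (star _) = g (star _)
      rw [map_star, map_star, h]
  ext b
  exact congrArg (fun k : PolOF F →ₐ[ℂ] A => k b) this

variable (F) in
/-- The matrix `U - 1`, with entries in the augmentation ideal. -/
def centered : Matrix ι ι (PolOF F) := fundMatrix F - 1

theorem counit_centered (i j : ι) : counit F (centered F i j) = 0 := by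
  rw [centered, Matrix.sub_apply, map_sub, counit_fundMatrix, Matrix.one_apply, Matrix.one_apply]
  split_ifs <;> simp

theorem centered_of_ne {i j : ι} (h : i ≠ j) : centered F i j = fundMatrix F i j := by
  simp [centered, h]

/-- Modulo products of elements of the augmentation ideal, the matrix `U - 1` is
anti-hermitian. -/
theorem star_centered (i j : ι) : star (centered F i j) =
    -centered F j i - ∑ k, star (centered F k j) * centered F k i := by
  have h : (centered F)ᴴ = -centered F - (centered F)ᴴ * centered F := by
    have h1 := (isOrthogonalMatrix_fundMatrix (F := F)).adjoint_mul
    have h2 : (centered F)ᴴ = (fundMatrix F)ᴴ - 1 := by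
      rw [centered, conjTranspose_sub, conjTranspose_one]
    rw [h2, centered]
    simp only [sub_mul, mul_sub, h1, one_mul, mul_one]
    abel
  simpa [Matrix.mul_apply] using congrFun (congrFun h j) i

/-- A subspace that contains the entries of `U - 1` and all products of two elements of the
augmentation ideal contains the augmentation ideal. -/
theorem mem_of_centered_mem (W : Submodule ℂ (PolOF F))
    (hmul : ∀ a b, counit F a = 0 → counit F b = 0 → a * b ∈ W)
    (hW : ∀ i j, centered F i j ∈ W) {b : PolOF F} (hb : counit F b = 0) : b ∈ W := by
  have hstar (i j : ι) : star (centered F i j) ∈ W := by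
    rw [star_centered]
    exact W.sub_mem (W.neg_mem (hW j i)) (W.sum_mem fun k _ =>
      hmul _ _ (by rw [map_star, counit_centered, star_zero]) (counit_centered k i))
  have hε (c : ℂ) : counit F (algebraMap ℂ _ c) = c := AlgHomClass.commutes _ c
  -- The projection `a ↦ a - ε(a)` onto `ker ε` is defined on the whole algebra, so induction over
  -- words applies.
  suffices h : ∀ a, a - algebraMap ℂ _ (counit F a) ∈ W by simpa [hb] using h b
  have hone (i j : ι) : algebraMap ℂ (PolOF F) ((1 : Matrix ι ι ℂ) i j) =
      (1 : Matrix ι ι (PolOF F)) i j := by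
    rw [Matrix.one_apply, Matrix.one_apply]
    split_ifs <;> simp
  intro a
  obtain ⟨a, rfl⟩ := UniversalStarAlgebra.mk_surjective a
  induction a using FreeStarAlgebra.induction with
  | h_scalar c => simp [hε]
  | h_letter y =>
    obtain ⟨⟨i, j⟩, _ | _⟩ := y
    · have h := hW i j
      rw [centered, Matrix.sub_apply, ← hone, ← counit_fundMatrix F] at h
      exact h
    · have h := hstar i j
      have h1 : star ((1 : Matrix ι ι (PolOF F)) i j) = (1 : Matrix ι ι (PolOF F)) i j := by
        rw [Matrix.one_apply]
        split_ifs <;> simp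
      rw [centered, Matrix.sub_apply, star_sub, h1, ← hone, ← counit_star F] at h
      have h2 : star (fundMatrix F i j) =
          UniversalStarAlgebra.mk (OrthogonalRel F) (FreeStarAlgebra.letter ((i, j), true)) := by
        rw [fundMatrix, Matrix.of_apply, UniversalStarAlgebra.of, ← UniversalStarAlgebra.mk_star,
          FreeStarAlgebra.of, FreeStarAlgebra.star_letter]
        rfl
      rwa [h2] at h
  | h_mul a b ha hb =>
    set a' := UniversalStarAlgebra.mk (OrthogonalRel F) a
    set b' := UniversalStarAlgebra.mk (OrthogonalRel F) b
    have h : a' * b' - algebraMap ℂ _ (counit F (a' * b')) =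
        (a' - algebraMap ℂ _ (counit F a')) * (b' - algebraMap ℂ _ (counit F b')) +
          (counit F a' • (b' - algebraMap ℂ _ (counit F b')) +
            counit F b' • (a' - algebraMap ℂ _ (counit F a'))) := by
      simp only [map_mul, Algebra.smul_def, sub_mul, mul_sub,
        Algebra.commutes (counit F b') a', Algebra.commutes (counit F b') (algebraMap ℂ _ _)]
      abel
    rw [map_mul, h]
    exact W.add_mem (hmul _ _ (by simp [hε]) (by simp [hε]))
      (W.add_mem (W.smul_mem _ hb) (W.smul_mem _ ha))
  | h_add a b ha hb =>
    have := W.add_mem ha hb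
    rw [map_add, map_add, map_add]
    convert this using 1
    abel

/-! ### Translations by characters -/

/-- Left translation `b ↦ χ(b₁) b₂`. -/
def leftTranslation (χ : PolOF F →⋆ₐ[ℂ] ℂ) : PolOF F →⋆ₐ[ℂ] PolOF F :=
  StarAlgHom.comp
    { (Algebra.TensorProduct.lid ℂ (PolOF F)).toAlgHom.comp
        (Algebra.TensorProduct.map χ.toAlgHom (AlgHom.id ℂ (PolOF F))) with
      map_star' := fun t => by
        induction t using TensorProduct.induction_on with
        | zero => simp
        | tmul a b => simp [map_star]
        | add a b ha hb => simp_all }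
    (comul F)

/-- Right translation `b ↦ b₁ χ(b₂)`. -/
def rightTranslation (χ : PolOF F →⋆ₐ[ℂ] ℂ) : PolOF F →⋆ₐ[ℂ] PolOF F :=
  StarAlgHom.comp
    { (Algebra.TensorProduct.rid ℂ ℂ (PolOF F)).toAlgHom.comp
        (Algebra.TensorProduct.map (AlgHom.id ℂ (PolOF F)) χ.toAlgHom) with
      map_star' := fun t => by
        induction t using TensorProduct.induction_on with
        | zero => simp
        | tmul a b => simp [map_star]
        | add a b ha hb => simp_all }
    (comul F)

theorem leftTranslation_fundMatrix (χ : PolOF F →⋆ₐ[ℂ] ℂ) (i j : ι) :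
    leftTranslation χ (fundMatrix F i j) = ∑ k, χ (fundMatrix F i k) • fundMatrix F k j := by
  change (Algebra.TensorProduct.lid ℂ (PolOF F))
    (Algebra.TensorProduct.map χ.toAlgHom (AlgHom.id ℂ (PolOF F)) (comul F _)) = _
  rw [comul_fundMatrix]
  simp

theorem rightTranslation_fundMatrix (χ : PolOF F →⋆ₐ[ℂ] ℂ) (i j : ι) :
    rightTranslation χ (fundMatrix F i j) = ∑ k, χ (fundMatrix F k j) • fundMatrix F i k := by
  change (Algebra.TensorProduct.rid ℂ ℂ (PolOF F))
    (Algebra.TensorProduct.map (AlgHom.id ℂ (PolOF F)) χ.toAlgHom (comul F _)) = _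
  rw [comul_fundMatrix]
  simp

/-- Centrality, spelled out as an identity between functionals on the coproduct. -/
theorem map_comul_comm {φ : PolOF F →ₗ[ℂ] ℂ} (h : IsCentralFunctional φ)
    (ψ : PolOF F →ₗ[ℂ] ℂ) (b : PolOF F) :
    LinearMap.mul' ℂ ℂ (TensorProduct.map φ ψ (comul F b)) =
      LinearMap.mul' ℂ ℂ (TensorProduct.map ψ φ (comul F b)) :=
  congrArg (fun f : WithConv (PolOF F →ₗ[ℂ] ℂ) => f.ofConv b) (h ψ)

/-- Centrality tested against the functional `χ` itself. -/
theorem map_leftTranslation {φ : PolOF F →ₗ[ℂ] ℂ} (h : IsCentralFunctional φ)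
    (χ : PolOF F →⋆ₐ[ℂ] ℂ) (b : PolOF F) :
    φ (leftTranslation χ b) = φ (rightTranslation χ b) := by
  have hl (t : PolOF F ⊗[ℂ] PolOF F) : φ ((Algebra.TensorProduct.lid ℂ (PolOF F))
      (Algebra.TensorProduct.map χ.toAlgHom (AlgHom.id ℂ (PolOF F)) t)) =
      LinearMap.mul' ℂ ℂ (TensorProduct.map χ.toAlgHom.toLinearMap φ t) := by
    induction t using TensorProduct.induction_on with
    | zero => simp
    | tmul a b => simp
    | add a b ha hb => simp_all
  have hr (t : PolOF F ⊗[ℂ] PolOF F) : φ ((Algebra.TensorProduct.rid ℂ ℂ (PolOF F))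
      (Algebra.TensorProduct.map (AlgHom.id ℂ (PolOF F)) χ.toAlgHom t)) =
      LinearMap.mul' ℂ ℂ (TensorProduct.map φ χ.toAlgHom.toLinearMap t) := by
    induction t using TensorProduct.induction_on with
    | zero => simp
    | tmul a b => simp [mul_comm]
    | add a b ha hb => simp_all
  exact (hl _).trans ((map_comul_comm h _ b).symm.trans (hr _).symm)

end PolOF

/-! ### Conjugation by scalar points -/

section Conjugation

variable {ι : Type*} [Fintype ι] [DecidableEq ι] {F : (Matrix ι ι ℂ)ˣ}

/-- Scalar points form a group, and `gᴴ` is the inverse of `g`. The relation `g = F ḡ F⁻¹` shows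
that `F ḡᴴ F⁻¹` is also a right inverse, so the two agree. -/
theorem IsOrthogonalMatrix.conjTranspose {g : Matrix ι ι ℂ} (h : IsOrthogonalMatrix F g) :
    IsOrthogonalMatrix F gᴴ := by
  have hc : (gᴴ).map star = (g.map star)ᴴ := rfl
  refine ⟨by simpa using h.adjoint_mul, by simpa using h.mul_adjoint, ?_, ?_, ?_⟩
  · rw [hc, conjTranspose_conjTranspose]
    exact h.conj_adjoint_mul
  · rw [hc, conjTranspose_conjTranspose]
    exact h.conj_mul_adjoint
  · rw [hc]
    have h1 : g * (scalarMatrix ℂ (F : Matrix ι ι ℂ) * (g.map star)ᴴ *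
        scalarMatrix ℂ ((F⁻¹ : (Matrix ι ι ℂ)ˣ) : Matrix ι ι ℂ)) = 1 := by
      nth_rewrite 1 [h.conj]
      simp only [mul_assoc]
      rw [← mul_assoc (scalarMatrix ℂ ((F⁻¹ : (Matrix ι ι ℂ)ˣ) : Matrix ι ι ℂ)),
        PolOF.scalarMatrix_inv_mul, one_mul, ← mul_assoc (g.map star), h.conj_mul_adjoint, one_mul,
        PolOF.scalarMatrix_mul_inv]
    calc gᴴ = gᴴ * (g * (scalarMatrix ℂ (F : Matrix ι ι ℂ) * (g.map star)ᴴ *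
        scalarMatrix ℂ ((F⁻¹ : (Matrix ι ι ℂ)ˣ) : Matrix ι ι ℂ))) := by rw [h1, mul_one]
      _ = _ := by rw [← mul_assoc, h.adjoint_mul, one_mul]

namespace PolOF

/-- Conjugation by a scalar point of the quantum group, `U ↦ g U gᴴ`. -/
def conjugation {g : Matrix ι ι ℂ} (h : IsOrthogonalMatrix F g) : PolOF F →⋆ₐ[ℂ] PolOF F :=
  (leftTranslation (lift g h)).comp (rightTranslation (lift gᴴ h.conjTranspose))

theorem conjugation_fundMatrix {g : Matrix ι ι ℂ} (h : IsOrthogonalMatrix F g) :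
    (fundMatrix F).map (conjugation h) =
      scalarMatrix (PolOF F) g * fundMatrix F * scalarMatrix (PolOF F) gᴴ := by
  ext i j
  simp only [conjugation, Matrix.map_apply, StarAlgHom.comp_apply, rightTranslation_fundMatrix,
    map_sum, map_smul, leftTranslation_fundMatrix, lift_fundMatrix, Matrix.mul_apply]
  refine Finset.sum_congr rfl fun k _ => ?_
  rw [Algebra.smul_def, Algebra.commutes]
  simp [Algebra.smul_def]

theorem scalarMatrix_mul_adjoint {g : Matrix ι ι ℂ} (h : IsOrthogonalMatrix F g) :
    scalarMatrix (PolOF F) g * scalarMatrix (PolOF F) gᴴ = 1 := by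
  rw [scalarMatrix, scalarMatrix, ← Matrix.map_mul, h.mul_adjoint,
    Matrix.map_one _ (map_zero _) (map_one _)]

/-- This is `g C = C' g` with `C'` the conjugate of `C`. Moving `gᴴ` to the other side leaves single
sums, which collapse for sparse `g`. -/
theorem conjugation_centered {g : Matrix ι ι ℂ} (h : IsOrthogonalMatrix F g) (i j : ι) :
    ∑ k, g i k • centered F k j = ∑ k, g k j • conjugation h (centered F i k) := by
  have h1 : (centered F).map (conjugation h) * scalarMatrix (PolOF F) g =
      scalarMatrix (PolOF F) g * centered F := by
    have h2 : scalarMatrix (PolOF F) gᴴ * scalarMatrix (PolOF F) g = 1 := by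
      simpa using scalarMatrix_mul_adjoint h.conjTranspose
    rw [centered, Matrix.map_sub _ (map_sub _), map_one_matrix, conjugation_fundMatrix, sub_mul,
      one_mul, mul_assoc, h2, mul_one, mul_sub, mul_one]
  have h3 := congrFun (congrFun h1 i) j
  simp only [Matrix.mul_apply, Matrix.map_apply] at h3
  simp only [Algebra.smul_def, ← h3]
  exact Finset.sum_congr rfl fun k _ => (Algebra.commutes _ _).symm

theorem counit_conjugation {g : Matrix ι ι ℂ} (h : IsOrthogonalMatrix F g) (b : PolOF F) :
    counit F (conjugation h b) = counit F b := by
  suffices hs : (counit F).comp (conjugation h) = counit F from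
    congrArg (fun f : PolOF F →⋆ₐ[ℂ] ℂ => f b) hs
  refine starAlgHom_ext fun i j => ?_
  have h1 : (fundMatrix F).map (counit F) = 1 := by
    ext i j
    exact counit_fundMatrix F i j
  have h2 := congrArg (fun M => Matrix.map M (counit F)) (conjugation_fundMatrix h)
  simp only [Matrix.map_mul, h1, map_scalarMatrix, mul_one] at h2
  have h3 : scalarMatrix ℂ g * scalarMatrix ℂ gᴴ = 1 := h.mul_adjoint
  rw [h3] at h2
  exact (congrFun (congrFun h2 i) j).trans (counit_fundMatrix F i j).symm

/-- A central functional is invariant under conjugation. -/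
theorem map_conjugation {φ : PolOF F →ₗ[ℂ] ℂ} (hφ : IsCentralFunctional φ) {g : Matrix ι ι ℂ}
    (h : IsOrthogonalMatrix F g) (b : PolOF F) : φ (conjugation h b) = φ b := by
  rw [conjugation, StarAlgHom.comp_apply, map_leftTranslation hφ]
  -- Centrality has turned the left translation by `g` into a right one, which cancels the right
  -- translation by `gᴴ`.
  suffices hs : (rightTranslation (lift g h)).comp (rightTranslation (lift gᴴ h.conjTranspose)) =
      StarAlgHom.id ℂ (PolOF F) from
    congrArg φ (congrArg (fun f : PolOF F →⋆ₐ[ℂ] PolOF F => f b) hs)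
  refine starAlgHom_ext fun i j => ?_
  have h1 : ∑ k, ∑ l, (gᴴ k j * g l k) • fundMatrix F i l = fundMatrix F i j := by
    rw [Finset.sum_comm]
    have h2 (l : ι) : ∑ k, gᴴ k j * g l k = (1 : Matrix ι ι ℂ) l j := by
      rw [← h.mul_adjoint, Matrix.mul_apply]
      exact Finset.sum_congr rfl fun k _ => mul_comm _ _
    simp_rw [← Finset.sum_smul, h2]
    simp [Matrix.one_apply]
  simpa [rightTranslation_fundMatrix, lift_fundMatrix, Finset.smul_sum, smul_smul] using h1

/-- `W` is invariant under conjugation and contains the products of two elements of the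
augmentation ideal. -/
structure IsConjInvariant (W : Submodule ℂ (PolOF F)) : Prop where
  mul_mem : ∀ a b, counit F a = 0 → counit F b = 0 → a * b ∈ W
  conj_mem : ∀ (g : Matrix ι ι ℂ) (h : IsOrthogonalMatrix F g) (b : PolOF F),
    b ∈ W → conjugation h b ∈ W

/-- Conjugation is a `*`-homomorphism preserving `φ`, so it preserves null vectors, and null vectors
make up the form kernel. -/
theorem isConjInvariant_formKernel {φ : PolOF F →ₗ[ℂ] ℂ}
    (hG : IsGaussianGeneratingFunctional (counit F) φ) (hφ : IsCentralFunctional φ) :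
    IsConjInvariant (formKernel (counit F) φ) where
  mul_mem _ _ ha hb := hG.mul_mem_formKernel ha hb
  conj_mem g h b hb := by
    have hε : counit F (conjugation h b) = 0 := by rw [counit_conjugation, hb.1]
    refine hG.mem_formKernel hε ?_
    rw [← map_star, ← map_mul, map_conjugation hφ]
    exact hb.2 _ (by rw [map_star, hb.1, star_zero])

/-- Modulo a conjugation-invariant subspace, `U - 1` is anti-hermitian. -/
theorem IsConjInvariant.star_centered_add_mem {W : Submodule ℂ (PolOF F)}
    (hW : IsConjInvariant W) (i j : ι) :
    star (centered F i j) + centered F j i ∈ W := by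
  rw [star_centered, add_comm, ← add_sub_assoc, add_neg_cancel, zero_sub]
  exact W.neg_mem (W.sum_mem fun k _ =>
    hW.mul_mem _ _ (by rw [map_star, counit_centered, star_zero]) (counit_centered k i))

/-! ### Diagonal points -/

/-- Diagonal matrices of self-adjoint involutions that are constant on the blocks of `F` satisfy
the defining relations. -/
theorem isOrthogonalMatrix_diagonal {A : Type*} [Ring A] [Algebra ℂ A] [StarRing A] (d : ι → A)
    (hd : ∀ k, star (d k) = d k) (hd' : ∀ k, d k * d k = 1)
    (hF : ∀ i j, d i ≠ d j → (F : Matrix ι ι ℂ) i j = 0) :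
    IsOrthogonalMatrix F (diagonal d) := by
  have h1 : (diagonal d).map star = diagonal d := by
    rw [diagonal_map (star_zero _)]
    exact congrArg diagonal (funext hd)
  have h2 : (diagonal d)ᴴ = diagonal d := by
    rw [diagonal_conjTranspose]
    exact congrArg diagonal (funext hd)
  have h3 : diagonal d * diagonal d = 1 := by
    rw [diagonal_mul_diagonal, ← diagonal_one]
    exact congrArg diagonal (funext hd')
  refine ⟨by rw [h2, h3], by rw [h2, h3], by rw [h1, h2, h3], by rw [h1, h2, h3], ?_⟩
  have h4 : scalarMatrix A (F : Matrix ι ι ℂ) * diagonal d =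
      diagonal d * scalarMatrix A (F : Matrix ι ι ℂ) := by
    ext i j
    rw [mul_diagonal, diagonal_mul]
    simp only [Matrix.map_apply]
    by_cases h : d i = d j
    · rw [h, Algebra.commutes]
    · rw [hF i j h, map_zero, zero_mul, mul_zero]
  rw [h1, h4, mul_assoc, scalarMatrix_mul_inv, mul_one]

/-- If `F` is block diagonal, a central functional vanishes on `u i j * u j i` for `i`, `j` in
different blocks. -/
theorem map_fundMatrix_mul {κ : Type*} [DecidableEq κ] (β : ι → κ)
    (hF : ∀ i j, β i ≠ β j → (F : Matrix ι ι ℂ) i j = 0)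
    {φ : PolOF F →ₗ[ℂ] ℂ} (hφ : IsCentralFunctional φ) {i j : ι} (hij : β i ≠ β j) :
    φ (fundMatrix F i j * fundMatrix F j i) = 0 := by
  -- Two anticommuting Pauli matrices on the blocks of `i` and `j`. Constancy on blocks makes the
  -- diagonal matrix compatible with `F`.
  let d : ι → Matrix (Fin 2) (Fin 2) ℂ := fun k =>
    if β k = β i then !![0, 1; 1, 0] else if β k = β j then !![1, 0; 0, -1] else 1
  have hd (k : ι) : star (d k) = d k := by
    simp only [d]
    split_ifs
    · ext a b; fin_cases a <;> fin_cases b <;> simp [Matrix.star_apply]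
    · ext a b; fin_cases a <;> fin_cases b <;> simp [Matrix.star_apply]
    · simp
  have hd' (k : ι) : d k * d k = 1 := by
    simp only [d]
    split_ifs <;> simp [Matrix.one_fin_two]
  have hM : IsOrthogonalMatrix F (diagonal d) := isOrthogonalMatrix_diagonal d hd hd' fun a b hab =>
    hF a b fun h => hab (by simp only [d, h])
  let π : PolOF F →⋆ₐ[ℂ] Matrix (Fin 2) (Fin 2) ℂ := lift (diagonal d) hM
  -- This entry is `-1` for `d j * d i` and `1` for `d i * d j`, so the two convolutions have
  -- opposite signs.
  let ψ : PolOF F →ₗ[ℂ] ℂ := Matrix.entryLinearMap ℂ ℂ (1 : Fin 2) (0 : Fin 2) ∘ₗ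
    π.toAlgHom.toLinearMap
  have hψ (a b c e : ι) : ψ (fundMatrix F a b * fundMatrix F c e) =
      (diagonal d a b * diagonal d c e) 1 0 := by
    change (π (fundMatrix F a b * fundMatrix F c e)) 1 0 = _
    rw [map_mul, lift_fundMatrix, lift_fundMatrix]
  have h := map_comul_comm hφ ψ (fundMatrix F i j * fundMatrix F j i)
  rw [map_mul, comul_fundMatrix, comul_fundMatrix] at h
  simp only [Finset.sum_mul_sum, Algebra.TensorProduct.tmul_mul_tmul, map_sum,
    TensorProduct.map_tmul, LinearMap.mul'_apply, hψ] at h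
  rw [Finset.sum_eq_single j, Finset.sum_eq_single i, Finset.sum_eq_single i,
    Finset.sum_eq_single j] at h
  · have hdi : d i = !![0, 1; 1, 0] := by simp [d]
    have hdj : d j = !![1, 0; 0, -1] := by simp [d, hij.symm]
    simp only [diagonal_apply_eq, hdi, hdj] at h
    simp at h
    linear_combination (-1 / 2 : ℂ) * h
  all_goals simp +contextual [diagonal_apply_ne, diagonal_apply_ne']

/-- Replacing `star (u i j)` by `-u j i` costs only a triple product, so `φ (star (u i j) * u i j)`
equals `-φ (u j i * u i j) = 0`. -/
theorem centered_mem_formKernel {κ : Type*} [DecidableEq κ] (β : ι → κ)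
    (hF : ∀ i j, β i ≠ β j → (F : Matrix ι ι ℂ) i j = 0) {φ : PolOF F →ₗ[ℂ] ℂ}
    (hG : IsGaussianGeneratingFunctional (counit F) φ) (hφ : IsCentralFunctional φ) {i j : ι}
    (hij : β i ≠ β j) : centered F i j ∈ formKernel (counit F) φ := by
  have hne : i ≠ j := fun h => hij (congrArg β h)
  refine hG.mem_formKernel (counit_centered i j) ?_
  rw [star_centered, sub_mul, neg_mul, map_sub, map_neg, centered_of_ne hne,
    centered_of_ne hne.symm, map_fundMatrix_mul β hF hφ hij.symm, neg_zero, zero_sub, neg_eq_zero,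
    Finset.sum_mul, map_sum]
  refine Finset.sum_eq_zero fun k _ => hG.map_mul_mul ?_ (counit_centered k i) ?_
  · rw [map_star, counit_centered, star_zero]
  · rw [← centered_of_ne hne, counit_centered]

theorem map_centered_eq_zero {κ : Type*} [DecidableEq κ] (β : ι → κ)
    (hF : ∀ i j, β i ≠ β j → (F : Matrix ι ι ℂ) i j = 0) {φ : PolOF F →ₗ[ℂ] ℂ}
    (hφ : IsCentralFunctional φ) {i j : ι} (hij : β i ≠ β j) : φ (centered F i j) = 0 := by
  -- Changing the sign on the block of `i` alone makes conjugation negate the entry `(i, j)`.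
  let d : ι → ℂ := fun k => if β k = β i then -1 else 1
  have hM : IsOrthogonalMatrix F (diagonal d) :=
    isOrthogonalMatrix_diagonal d (fun k => by simp only [d]; split_ifs <;> simp)
      (fun k => by simp only [d]; split_ifs <;> simp)
      fun a b hab => hF a b fun h => hab (by simp only [d, h])
  have h := congrArg φ (conjugation_centered hM i j)
  simp only [map_sum, map_smul, map_conjugation hφ, diagonal_apply] at h
  simp [d, hij.symm] at h
  linear_combination (-1 / 2 : ℂ) * h

/-- The criterion behind both cases: it suffices that conjugation-invariant subspaces containing
the off-diagonal blocks of `U - 1` contain all of `U - 1`. -/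
theorem eq_zero_of_isConjInvariant {κ : Type*} [DecidableEq κ] (β : ι → κ)
    (hF : ∀ i j, β i ≠ β j → (F : Matrix ι ι ℂ) i j = 0)
    (hW : ∀ W : Submodule ℂ (PolOF F), IsConjInvariant W →
      (∀ i j, β i ≠ β j → centered F i j ∈ W) → ∀ i j, centered F i j ∈ W)
    {φ : PolOF F →ₗ[ℂ] ℂ} (hG : IsGaussianGeneratingFunctional (counit F) φ)
    (hφ : IsCentralFunctional φ) : φ = 0 := by
  have hmul (a b : PolOF F) (ha : counit F a = 0) (hb : counit F b = 0) : φ (a * b) = 0 := by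
    have hL := isConjInvariant_formKernel hG hφ
    exact (mem_of_centered_mem _ hL.mul_mem
      (hW _ hL fun i j hij => centered_mem_formKernel β hF hG hφ hij) hb).2 a ha
  -- Only now, with `φ` zero on `(ker ε)²`, does `ker φ` qualify as a conjugation-invariant
  -- subspace.
  have hK : IsConjInvariant (LinearMap.ker φ) :=
    ⟨hmul, fun g h b hb => by rw [LinearMap.mem_ker, map_conjugation hφ]; exact hb⟩
  ext b
  have h : φ (b - algebraMap ℂ _ (counit F b)) = 0 := mem_of_centered_mem _ hK.mul_mem
    (hW _ hK fun i j hij => map_centered_eq_zero β hF hφ hij)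
    (by rw [map_sub, AlgHomClass.commutes]; exact sub_self _)
  rwa [map_sub, Algebra.algebraMap_eq_smul_one, map_smul, hG.map_one, smul_zero, sub_zero] at h

end PolOF

end Conjugation

/-! ### The free orthogonal case -/

namespace PolOPlus

variable {N : ℕ}

theorem star_centered (i j : Fin N) :
    star (PolOF.centered (1 : (Matrix (Fin N) (Fin N) ℂ)ˣ) i j) = PolOF.centered 1 i j := by
  have h := (PolOF.isOrthogonalMatrix_fundMatrix (F := (1 : (Matrix (Fin N) (Fin N) ℂ)ˣ))).conj
  have h1 : scalarMatrix (PolOPlus N) (1 : Matrix (Fin N) (Fin N) ℂ) = 1 :=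
    Matrix.map_one _ (map_zero _) (map_one _)
  simp only [inv_one, Units.val_one, h1, one_mul, mul_one] at h
  have h2 : (1 : Matrix (Fin N) (Fin N) (PolOPlus N)).map star = 1 :=
    Matrix.map_one _ (star_zero _) (star_one _)
  have h3 : (PolOF.centered (1 : (Matrix (Fin N) (Fin N) ℂ)ˣ)).map star = PolOF.centered 1 := by
    rw [PolOF.centered, Matrix.map_sub _ (star_sub), ← h, h2]
  exact congrFun (congrFun h3 i) j

/-- A diagonal entry is self-adjoint, and anti-hermitian modulo `W`, so twice it lies in `W`. -/
theorem centered_mem {W : Submodule ℂ (PolOPlus N)} (hW : PolOF.IsConjInvariant W)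
    (h : ∀ i j, i ≠ j → PolOF.centered 1 i j ∈ W) (i j : Fin N) : PolOF.centered 1 i j ∈ W := by
  by_cases hij : i = j
  · subst hij
    have h1 := hW.star_centered_add_mem i i
    rw [star_centered, ← two_smul ℂ] at h1
    exact (W.smul_mem_iff two_ne_zero).1 h1
  · exact h i j hij

end PolOPlus

section Scalar

variable {ι : Type*} [Fintype ι] [DecidableEq ι] {F : (Matrix ι ι ℂ)ˣ}

/-- For scalar matrices, the relations reduce to one unitarity relation and `g F = F ḡ`. -/
theorem isOrthogonalMatrix_of_unitary {g : Matrix ι ι ℂ} (h : g * gᴴ = 1)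
    (hF : g * (F : Matrix ι ι ℂ) = F * g.map star) : IsOrthogonalMatrix F g := by
  have h1 : g.map star * (g.map star)ᴴ = 1 := by
    have := congrArg (fun M : Matrix ι ι ℂ => M.map (starRingEnd ℂ)) h
    simp only [Matrix.map_mul, Matrix.map_one _ (map_zero _) (map_one _)] at this
    exact this
  refine ⟨h, mul_eq_one_comm.1 h, h1, mul_eq_one_comm.1 h1, ?_⟩
  change g = (F : Matrix ι ι ℂ) * g.map star * ((F⁻¹ : (Matrix ι ι ℂ)ˣ) : Matrix ι ι ℂ)
  rw [← hF, mul_assoc, Units.mul_inv, mul_one]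

end Scalar

/-! ### The free symplectic case -/

namespace PolOJPlus

variable {N : ℕ}

theorem val_symplecticJ : ((symplecticJ N : (Matrix (Fin N ⊕ Fin N) (Fin N ⊕ Fin N) ℂ)ˣ) :
    Matrix (Fin N ⊕ Fin N) (Fin N ⊕ Fin N) ℂ) = fromBlocks 0 1 (-1) 0 := rfl

/-- Diagonal matrices of unit quaternions `a k + b k j`. -/
theorem isOrthogonalMatrix_quaternion (a b : Fin N → ℂ)
    (h : ∀ k, a k * star (a k) + b k * star (b k) = 1) :
    IsOrthogonalMatrix (symplecticJ N) (fromBlocks (diagonal a) (diagonal b)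
      (diagonal (-star b)) (diagonal (star a))) := by
  apply isOrthogonalMatrix_of_unitary
  · rw [fromBlocks_conjTranspose, fromBlocks_multiply, ← fromBlocks_one]
    simp only [diagonal_conjTranspose, diagonal_mul_diagonal, diagonal_add, ← diagonal_one,
      ← diagonal_zero]
    congr 2 <;> funext k <;> have hk := h k <;>
      simp only [RCLike.star_def] at hk <;> simp <;> first | ring1 | linear_combination hk
  · rw [val_symplecticJ, fromBlocks_map, fromBlocks_multiply, fromBlocks_multiply]
    simp only [diagonal_map (star_zero ℂ)]
    congr 1 <;> ext i j <;> by_cases hij : i = j <;> simp [hij]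

/-- A real orthogonal matrix acts on quaternionic vectors. -/
theorem isOrthogonalMatrix_real (R : Matrix (Fin N) (Fin N) ℂ) (h : R * Rᴴ = 1)
    (hR : R.map star = R) : IsOrthogonalMatrix (symplecticJ N) (fromBlocks R 0 0 R) := by
  apply isOrthogonalMatrix_of_unitary
  · simp [fromBlocks_conjTranspose, fromBlocks_multiply, h]
  · have h0 : (0 : Matrix (Fin N) (Fin N) ℂ).map star = 0 := by ext; simp
    rw [val_symplecticJ, fromBlocks_map, fromBlocks_multiply, fromBlocks_multiply, hR, h0]
    simp

/-- Two coordinates can be mixed by a real orthogonal matrix. -/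
theorem exists_real_orthogonal {p q : Fin N} (hpq : p ≠ q) :
    ∃ R : Matrix (Fin N) (Fin N) ℂ, R * Rᴴ = 1 ∧ R.map star = R ∧ R p p ≠ 0 ∧ R p q ≠ 0 := by
  -- The reflection in the hyperplane orthogonal to `e_p + 2 e_q` has entries `R p p = 3/5` and `R p
  -- q = -4/5`. The unequal weights keep `R p p` from vanishing.
  let w : Fin N → ℂ := Pi.single p 1 + Pi.single q 2
  have hw : star w = w := by
    ext k
    simp only [w, Pi.star_apply, Pi.add_apply, Pi.single_apply]
    split_ifs <;> simp
  have hww : w ⬝ᵥ w = 5 := by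
    simp [w, hpq, hpq.symm]
    norm_num
  have hS : (vecMulVec w w)ᴴ = vecMulVec w w := by rw [conjTranspose_vecMulVec, hw]
  have hSS : vecMulVec w w * vecMulVec w w = (5 : ℂ) • vecMulVec w w := by
    rw [vecMulVec_mul_vecMulVec, hww]
    ext; simp [vecMulVec_apply]; ring
  refine ⟨1 - (2 / 5 : ℂ) • vecMulVec w w, ?_, ?_, ?_, ?_⟩
  · rw [conjTranspose_sub, conjTranspose_smul, hS, conjTranspose_one]
    have h5 : star (2 / 5 : ℂ) = 2 / 5 := by simp
    rw [h5]
    simp only [sub_mul, mul_sub, smul_mul_assoc, mul_smul_comm, hSS, smul_smul, one_mul, mul_one]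
    match_scalars <;> norm_num
  · ext i j
    have h1 : star (w i) = w i := congrFun hw i
    have h2 : star (w j) = w j := congrFun hw j
    simp only [RCLike.star_def] at h1 h2
    have h5 : (starRingEnd ℂ) (2 / 5 : ℂ) = 2 / 5 := by
      rw [map_div₀, map_ofNat, map_ofNat]
    have h3 : (starRingEnd ℂ) ((1 : Matrix (Fin N) (Fin N) ℂ) i j) =
        (1 : Matrix (Fin N) (Fin N) ℂ) i j := by
      rw [Matrix.one_apply]
      split_ifs <;> simp
    simp only [Matrix.map_apply, Matrix.sub_apply, Matrix.smul_apply, vecMulVec_apply, smul_eq_mul,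
      RCLike.star_def, map_sub, map_mul, h1, h2, h3, h5]
  · simp [vecMulVec_apply, w, hpq]
    norm_num
  · simp [vecMulVec_apply, w, hpq, hpq.symm]

/-- In block form, `U = J Ū J⁻¹` makes the lower right block the entrywise adjoint of the upper left
one. -/
theorem centered_inr_inr (p q : Fin N) :
    PolOF.centered (symplecticJ N) (.inr p) (.inr q) =
      star (PolOF.centered (symplecticJ N) (.inl p) (.inl q)) := by
  have h := (PolOF.isOrthogonalMatrix_fundMatrix (F := symplecticJ N)).conj
  have h1 : ((symplecticJ N)⁻¹ : (Matrix (Fin N ⊕ Fin N) (Fin N ⊕ Fin N) ℂ)ˣ).val =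
    -fromBlocks 0 1 (-1) 0 := rfl
  rw [val_symplecticJ, h1] at h
  have h2 := congrFun (congrFun h (.inr p)) (.inr q)
  simp only [Matrix.mul_apply, Fintype.sum_sum_type] at h2
  simp [Matrix.one_apply, Finset.sum_ite_eq, apply_ite (algebraMap ℂ (PolOJPlus N))] at h2
  rw [PolOF.centered, Matrix.sub_apply, Matrix.sub_apply, star_sub, h2, Matrix.one_apply,
    Matrix.one_apply]
  simp [apply_ite star]

variable {W : Submodule ℂ (PolOJPlus N)}

/-- Modulo `W`, only one term survives on each side of `R C = C' R`, and both survivors carry the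
factor `R p q`. The choices of `s` and `t` treat the four entries of a block at once. -/
theorem sub_conjugation_mem (hW : PolOF.IsConjInvariant W)
    (h : ∀ i j : Fin N ⊕ Fin N, Sum.elim id id i ≠ Sum.elim id id j →
      PolOF.centered (symplecticJ N) i j ∈ W) {R : Matrix (Fin N) (Fin N) ℂ}
    (hR : IsOrthogonalMatrix (symplecticJ N) (fromBlocks R 0 0 R)) {p q : Fin N} (hpq : R p q ≠ 0)
    {s t : Fin N → Fin N ⊕ Fin N} (hs : s = Sum.inl ∨ s = Sum.inr)
    (ht : t = Sum.inl ∨ t = Sum.inr) :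
    PolOF.centered (symplecticJ N) (s q) (t q) -
      PolOF.conjugation hR (PolOF.centered (symplecticJ N) (s p) (t p)) ∈ W := by
  have h1 : ∑ m, R p m • PolOF.centered (symplecticJ N) (s m) (t q) =
      ∑ m, R m q • PolOF.conjugation hR (PolOF.centered (symplecticJ N) (s p) (t m)) := by
    have := PolOF.conjugation_centered hR (s p) (t q)
    rcases hs with rfl | rfl <;> rcases ht with rfl | rfl <;>
      simpa [Fintype.sum_sum_type] using this
  have hβ (m n : Fin N) (hmn : m ≠ n) : PolOF.centered (symplecticJ N) (s m) (t n) ∈ W := by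
    apply h
    rcases hs with rfl | rfl <;> rcases ht with rfl | rfl <;> simpa using hmn
  rw [← Finset.add_sum_erase _ _ (Finset.mem_univ q),
    ← Finset.add_sum_erase _ _ (Finset.mem_univ p)] at h1
  rw [← W.smul_mem_iff hpq, smul_sub, sub_eq_sub_iff_add_eq_add.2 (h1.trans (add_comm _ _))]
  refine W.sub_mem (W.sum_mem fun m hm => W.smul_mem _ (hW.conj_mem _ hR _ ?_))
    (W.sum_mem fun m hm => W.smul_mem _ ?_)
  · exact hβ _ _ (Finset.ne_of_mem_erase hm).symm
  · exact hβ _ _ (Finset.ne_of_mem_erase hm)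

/-- Modulo `W`, the diagonal blocks of `U - 1` are all equal. -/
theorem centered_sub_mem (hW : PolOF.IsConjInvariant W)
    (h : ∀ i j : Fin N ⊕ Fin N, Sum.elim id id i ≠ Sum.elim id id j →
      PolOF.centered (symplecticJ N) i j ∈ W) {p q : Fin N} (hpq : p ≠ q)
    {s t : Fin N → Fin N ⊕ Fin N} (hs : s = Sum.inl ∨ s = Sum.inr)
    (ht : t = Sum.inl ∨ t = Sum.inr) :
    PolOF.centered (symplecticJ N) (s p) (t p) -
      PolOF.centered (symplecticJ N) (s q) (t q) ∈ W := by
  obtain ⟨R, h1, h2, hpp, hpq⟩ := exists_real_orthogonal hpq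
  have hR := isOrthogonalMatrix_real R h1 h2
  -- As `R p p` and `R p q` are both nonzero, the same conjugated entry is congruent to the entries
  -- at `p` and at `q`.
  have := W.sub_mem (sub_conjugation_mem hW h hR hpp hs ht) (sub_conjugation_mem hW h hR hpq hs ht)
  rwa [sub_sub_sub_cancel_right] at this

/-- Conjugation by the quaternion `i` at `p` only negates these entries at `p` and fixes those at
`q`, while the two are congruent modulo `W`. -/
theorem centered_off_mem (hW : PolOF.IsConjInvariant W)
    (h : ∀ i j : Fin N ⊕ Fin N, Sum.elim id id i ≠ Sum.elim id id j →
      PolOF.centered (symplecticJ N) i j ∈ W) {p q : Fin N} (hpq : p ≠ q) :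
    PolOF.centered (symplecticJ N) (.inl p) (.inr p) ∈ W ∧
      PolOF.centered (symplecticJ N) (.inr p) (.inl p) ∈ W := by
  have hg := isOrthogonalMatrix_quaternion (N := N) (fun k => if k = p then Complex.I else 1) 0
    (fun k => by split_ifs <;> simp)
  have key {s t : Fin N → Fin N ⊕ Fin N} (hs : s = Sum.inl ∨ s = Sum.inr)
      (ht : t = Sum.inl ∨ t = Sum.inr)
      (h1 : PolOF.conjugation hg (PolOF.centered (symplecticJ N) (s p) (t p)) =
        -PolOF.centered (symplecticJ N) (s p) (t p))
      (h2 : PolOF.conjugation hg (PolOF.centered (symplecticJ N) (s q) (t q)) =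
        PolOF.centered (symplecticJ N) (s q) (t q)) :
      PolOF.centered (symplecticJ N) (s p) (t p) ∈ W := by
    have h3 := centered_sub_mem hW h hpq hs ht
    have h4 := hW.conj_mem _ hg _ h3
    rw [map_sub, h1, h2] at h4
    have h5 := W.sub_mem h3 h4
    rw [sub_sub_sub_cancel_right, sub_neg_eq_add, ← two_smul ℂ] at h5
    exact (W.smul_mem_iff two_ne_zero).1 h5
  have hII (a b : PolOJPlus N) (hab : Complex.I • a = -(Complex.I • b)) : b = -a := by
    rw [← smul_neg] at hab
    rw [smul_right_injective _ Complex.I_ne_zero hab, neg_neg]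
  constructor
  · refine key (.inl rfl) (.inr rfl) (hII _ _ ?_) ?_
    · have := PolOF.conjugation_centered hg (.inl p) (.inr p)
      simpa [Fintype.sum_sum_type, diagonal_apply] using this
    · have := PolOF.conjugation_centered hg (.inl q) (.inr q)
      simpa [Fintype.sum_sum_type, diagonal_apply, hpq.symm] using this.symm
  · refine key (.inr rfl) (.inl rfl) (hII _ _ ?_) ?_
    · have := PolOF.conjugation_centered hg (.inr p) (.inl p)
      simpa [Fintype.sum_sum_type, diagonal_apply, neg_eq_iff_eq_neg] using this
    · have := PolOF.conjugation_centered hg (.inr q) (.inl q)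
      simpa [Fintype.sum_sum_type, diagonal_apply, hpq.symm] using this.symm

/-- Let `x_p`, `x_q` be the entries at `p` and `q`. Conjugation by the quaternion `j` at `p` only
takes `x_p - x_q ∈ W` to `star x_p - x_q ∈ W`. Together with `star x_p + x_p ∈ W` this gives `2 x_p
∈ W`. -/
theorem centered_inl_inl_mem (hW : PolOF.IsConjInvariant W)
    (h : ∀ i j : Fin N ⊕ Fin N, Sum.elim id id i ≠ Sum.elim id id j →
      PolOF.centered (symplecticJ N) i j ∈ W) {p q : Fin N} (hpq : p ≠ q) :
    PolOF.centered (symplecticJ N) (.inl p) (.inl p) ∈ W := by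
  have hg := isOrthogonalMatrix_quaternion (N := N) (fun k => if k = p then 0 else 1)
    (fun k => if k = p then 1 else 0) (fun k => by split_ifs <;> simp)
  have h1 : PolOF.conjugation hg (PolOF.centered (symplecticJ N) (.inl p) (.inl p)) =
      PolOF.centered (symplecticJ N) (.inr p) (.inr p) := by
    have := PolOF.conjugation_centered hg (.inl p) (.inr p)
    simpa [Fintype.sum_sum_type, diagonal_apply] using this.symm
  have h2 : PolOF.conjugation hg (PolOF.centered (symplecticJ N) (.inl q) (.inl q)) =
      PolOF.centered (symplecticJ N) (.inl q) (.inl q) := by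
    have := PolOF.conjugation_centered hg (.inl q) (.inl q)
    simpa [Fintype.sum_sum_type, diagonal_apply, hpq.symm] using this.symm
  have h3 := centered_sub_mem hW h hpq (.inl rfl) (.inl rfl)
  have h4 := hW.conj_mem _ hg _ h3
  rw [map_sub, h1, h2, centered_inr_inr] at h4
  have h5 := W.sub_mem (W.add_mem h3 (hW.star_centered_add_mem (.inl p) (.inl p))) h4
  have h6 : ∀ a b c : PolOJPlus N, a - b + (c + a) - (c - b) = (2 : ℂ) • a := fun a b c => by
    rw [two_smul]
    abel
  rw [h6] at h5
  exact (W.smul_mem_iff two_ne_zero).1 h5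

theorem centered_mem (hN : 2 ≤ N) (hW : PolOF.IsConjInvariant W)
    (h : ∀ i j : Fin N ⊕ Fin N, Sum.elim id id i ≠ Sum.elim id id j →
      PolOF.centered (symplecticJ N) i j ∈ W) (i j : Fin N ⊕ Fin N) :
    PolOF.centered (symplecticJ N) i j ∈ W := by
  by_cases hij : Sum.elim id id i = Sum.elim id id j
  · have : Nontrivial (Fin N) := Fin.nontrivial_iff_two_le.2 hN
    rcases i with p | p <;> rcases j with p' | p' <;>
      simp only [Sum.elim_inl, Sum.elim_inr, id] at hij <;>
      subst hij <;> obtain ⟨q, hq⟩ := exists_ne p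
    · exact centered_inl_inl_mem hW h hq.symm
    · exact (centered_off_mem hW h hq.symm).1
    · exact (centered_off_mem hW h hq.symm).2
    · have h1 := W.sub_mem (hW.star_centered_add_mem (.inl p) (.inl p))
        (centered_inl_inl_mem hW h hq.symm)
      rwa [add_sub_cancel_right, ← centered_inr_inr] at h1
  · exact h i j hij

end PolOJPlus

end

theorem mainTheorem5 (N : ℕ) (hN : 2 ≤ N) :
    (∀ φ : PolOPlus N →ₗ[ℂ] ℂ,
      IsGaussianGeneratingFunctional (PolOF.counit (1 : (Matrix (Fin N) (Fin N) ℂ)ˣ)) φ →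
      IsCentralFunctional φ → φ = 0) ∧
    (∀ φ : PolOJPlus N →ₗ[ℂ] ℂ,
      IsGaussianGeneratingFunctional (PolOF.counit (symplecticJ N)) φ →
      IsCentralFunctional φ → φ = 0) := by
  constructor
  · intro φ hG hφ
    refine PolOF.eq_zero_of_isConjInvariant id (fun i j hij => ?_)
      (fun W hW h => PolOPlus.centered_mem hW h) hG hφ
    simpa [Matrix.one_apply] using hij
  · intro φ hG hφ
    refine PolOF.eq_zero_of_isConjInvariant (Sum.elim id id) (fun i j hij => ?_)
      (fun W hW h => PolOJPlus.centered_mem hN hW h) hG hφ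
    rw [PolOJPlus.val_symplecticJ]
    rcases i with p | p <;> rcases j with q | q <;> simp at hij <;> simp [hij]
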